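/- Let $\Phi:[0,\infty)\to\mathbb{R}$ be convex and nondecreasing with $\Phi(0)=0$ (the depth-of-discharge stress function), and let $T\in\mathbb{N}$. For a state-of-charge series $\mathbf{s}\in\mathbb{R}^T$ let $[d_1,\dots,d_N]=\mathbf{Rainflow}(\mathbf{s})$ be the list of depths of all charging and discharging half cycles found by the rainflow algorithm, as follows. 1. Reduce $\mathbf{s}$ to its turning points (its local maxima and minima, including the first and the last point). 2. The global maximum and the global minimum form a half cycle; its depth is the absolute difference of the two values. 3. If the global maximum comes first, half cycles are also counted, going backward in time, between the global maximum and the lowest minimum before it, between that minimum and the highest maximum before it, and so on to the beginning; and, going forward in time, between the global minimum and the highest maximum after it, between that maximum and the lowest minimum after it, and so on to the end. If the global minimum comes first, the roles of maxima and minima are exchanged. 4. The turning points strictly between the two ends of one of these half cycles form full cycles: in the sequence of turning points from one end to the other, whenever four consecutive points $a,b,c,d$ satisfy $|b-c|\le|a-b|$ and $|b-c|\le|c-d|$, the pair $b,c$ is a full cycle of depth $|b-c|$ and is removed; this is repeated until only the two ends are left. A full cycle counts as one charging and one discharging half cycle, so its depth appears twice in the list. (A constant or empty series has no cycles.) Then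 the degradation cost $$f(\mathbf{s})=\sum_{i=1}^{N}\Phi(d_i)$$ is a convex function on $\mathbb{R}^T$: for all $\mathbf{s}_1,\mathbf{s}_2\in\mathbb{R}^T$ and all $\lambda\in[0,1]$, $$f(\lambda\mathbf{s}_1+(1-\lambda)\mathbf{s}_2)\le\lambda f(\mathbf{s}_1)+(1-\lambda)f(\mathbf{s}_2).$$ -/

import Mathlib

noncomputable section

namespace Rainflow

/-- The turning points of a finite real sequence: a point is deleted if it lies (weakly) between
its retained predecessor and its successor. The first and the last point are retained (a constant
sequence is reduced to a single point). -/
def turningPoints : List ℝ → List ℝ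
  | [] => []
  | [a] => [a]
  | [a, b] => if a = b then [a] else [a, b]
  | a :: b :: c :: l =>
      if (a ≤ b ∧ b ≤ c) ∨ (c ≤ b ∧ b ≤ a) then turningPoints (a :: c :: l)
      else a :: turningPoints (b :: c :: l)
  termination_by l => l.length

/-- Largest entry of a nonempty list. -/
def maxOf (l : List ℝ) : ℝ := l.max?.getD 0

/-- Smallest entry of a nonempty list. -/
def minOf (l : List ℝ) : ℝ := l.min?.getD 0

/-- Let `x` be a global extremum of the sequence `x :: l`. The sequence is cut at the global
minimum of `l` (if `toMax = false`) or at the global maximum of `l` (if `toMax = true`), then at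
the opposite extremum of what comes after that point, and so on, alternating, to the end.
The result is the list of pieces; each piece contains both of its end points. -/
def legs (x : ℝ) (toMax : Bool) : List ℝ → List (List ℝ)
  | [] => []
  | z :: zs =>
      let y := if toMax then maxOf (z :: zs) else minOf (z :: zs)
      let k := (z :: zs).idxOf y
      (x :: (z :: zs).take (k + 1)) :: legs y (!toMax) ((z :: zs).drop (k + 1))
  termination_by l => l.length
  decreasing_by simp

/-- All pieces whose two end points are the ends of a half cycle, for a list `p` of turning points.
The main piece joins the global maximum and the global minimum. If the maximum comes first, then,
going back in time from it, one alternates between the lowest minimum before it, the highest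
maximum before that, and so on to the beginning; going forward from the global minimum, one
alternates between the highest maximum after it, the lowest minimum after that, and so on to the
end. If the minimum comes first, the roles are exchanged. Pieces that precede the main piece are
listed in reversed time. -/
def allLegs (p : List ℝ) : List (List ℝ) :=
  let i := p.idxOf (maxOf p)
  let j := p.idxOf (minOf p)
  if i < j then
    ((p.take (j + 1)).drop i) :: (legs (maxOf p) false (p.take i).reverse
      ++ legs (minOf p) true (p.drop (j + 1)))
  else if j < i then
    ((p.take (i + 1)).drop j) :: (legs (minOf p) true (p.take j).reverse
      ++ legs (maxOf p) false (p.drop (i + 1)))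
  else []

/-- Depths of the full cycles inside a piece. The points are read one after the other and kept on
a stack (first argument, most recent point first). Whenever the range `|b - c|` of two consecutive
points is at most the ranges `|a - b|` and `|c - d|` next to it, the pair `b, c` closes a full cycle
of depth `|b - c|` and is removed. -/
def fullCycles : List ℝ → List ℝ → List ℝ
  | _, [] => []
  | c :: b :: a :: st, d :: l =>
      if |b - c| ≤ |a - b| ∧ |b - c| ≤ |c - d| then |b - c| :: fullCycles (a :: st) (d :: l)
      else fullCycles (d :: c :: b :: a :: st) l
  | st, d :: l => fullCycles (d :: st) l
  termination_by st l => 2 * l.length + st.length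
  decreasing_by all_goals (simp only [List.length_cons]; omega)

/-- Depth of the half cycle between the two ends of a piece. -/
def halfCycleDepth (leg : List ℝ) : ℝ := |leg.headD 0 - leg.getLastD 0|

/-- Half-cycle depths contributed by one piece: the half cycle between its ends, and two half
cycles (one charging, one discharging) of equal depth for each full cycle in the remainder. -/
def legDepths (leg : List ℝ) : List ℝ :=
  halfCycleDepth leg :: (fullCycles [] leg ++ fullCycles [] leg)

/-- The list `[d₁, …, d_N]` of all charging and discharging half-cycle depths of a sequence. -/
def rainflow (s : List ℝ) : List ℝ :=
  (allLegs (turningPoints s)).flatMap legDepths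

/-- The degradation cost `f(s) = ∑ᵢ Φ(dᵢ)` of a profile `s ∈ ℝ^T`. -/
def degradationCost (Φ : ℝ → ℝ) {T : ℕ} (s : Fin T → ℝ) : ℝ :=
  ((rainflow (List.ofFn s)).map Φ).sum

end Rainflow

end

namespace Rainflow

/-! For a hinge `Φ d = max (d - 2 * r) 0` the degradation cost has a variational form: it is the
least total variation of a path staying within `r` of the series (`isLeast_excess_rainflow`). For a
given start the minimizer is the play operator, which moves only when the tube pushes it
(`playVar_cons_le`). A convex combination of paths in the tubes of `s` and `t` lies in the tube of
the combined series, and variation is convex; hence `playVar_convex`, and minimizing over the start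
preserves convexity.

The variational form mirrors the algorithm. Points inside monotone runs do not affect the play, and
a full cycle of depth `d` adds exactly `2 * max (d - 2 * r) 0` (`playVar_cycle`). Variation does not
depend on the direction of time, so the optimal path can be cut at a global extremum and followed
both ways from the inner edge of its tube (`isLeast_playVar_of_max`); each half cycle then costs one
hinge (`excess_legs`).

For general `Φ`, one convexity inequality involves finitely many depths, and on these `Φ` agrees
with a nonnegative combination of hinges (`exists_eqOn_of_convexOn`). -/

/-! ### Play operator: minimality and convexity of its variation -/

/-- Projection of `y` to the interval of radius `r` around `z`. -/
noncomputable def clamp (r z y : ℝ) : ℝ := max (z - r) (min (z + r) y)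

/-- Total variation of the play operator of radius `r` started at `y` and driven by a list. -/
noncomputable def playVar (r : ℝ) : ℝ → List ℝ → ℝ
  | _, [] => 0
  | y, z :: l => |y - clamp r z y| + playVar r (clamp r z y) l

variable {r : ℝ}

lemma clamp_mem (hr : 0 ≤ r) (z y : ℝ) : z - r ≤ clamp r z y ∧ clamp r z y ≤ z + r := by
  unfold clamp
  exact ⟨le_max_left _ _, max_le (by linarith) (min_le_left _ _)⟩

lemma clamp_of_le (hr : 0 ≤ r) {z y : ℝ} (h : y ≤ z - r) : clamp r z y = z - r := by
  unfold clamp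
  rw [min_eq_right (by linarith), max_eq_left h]

lemma clamp_of_ge (hr : 0 ≤ r) {z y : ℝ} (h : z + r ≤ y) : clamp r z y = z + r := by
  unfold clamp
  rw [min_eq_left h, max_eq_right (by linarith)]

lemma clamp_of_mem {z y : ℝ} (h1 : z - r ≤ y) (h2 : y ≤ z + r) : clamp r z y = y := by
  unfold clamp
  rw [min_eq_right h2, max_eq_right h1]

lemma clamp_neg (hr : 0 ≤ r) (z y : ℝ) : clamp r (-z) (-y) = -clamp r z y := by
  rcases le_total y (z - r) with h | h
  · rw [clamp_of_le hr h, clamp_of_ge hr (by linarith)]; ring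
  rcases le_total y (z + r) with h' | h'
  · rw [clamp_of_mem h h', clamp_of_mem (by linarith) (by linarith)]
  · rw [clamp_of_ge hr h', clamp_of_le hr (by linarith)]; ring

/-- The projection onto the interval lies between `y` and every point of the interval, so the
triangle inequality is an equality. -/
lemma abs_sub_clamp_add (hr : 0 ≤ r) {z y y' : ℝ} (h1 : z - r ≤ y') (h2 : y' ≤ z + r) :
    |y - clamp r z y| + |clamp r z y - y'| = |y - y'| := by
  rcases le_total y (z - r) with h | h
  · rw [clamp_of_le hr h, abs_of_nonpos (by linarith), abs_of_nonpos (by linarith),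
      abs_of_nonpos (by linarith)]; ring
  rcases le_total y (z + r) with h' | h'
  · rw [clamp_of_mem h h']; simp
  · rw [clamp_of_ge hr h', abs_of_nonneg (by linarith), abs_of_nonneg (by linarith),
      abs_of_nonneg (by linarith)]; ring

lemma playVar_nonneg (r : ℝ) (l : List ℝ) (y : ℝ) : 0 ≤ playVar r y l := by
  induction l generalizing y with
  | nil => simp [playVar]
  | cons z l ih => have := ih (clamp r z y); have := abs_nonneg (y - clamp r z y)
                   simp only [playVar]; linarith

/-- Reflection symmetry, by which ascending and minimum cases follow from descending and maximum
ones, and conversely. -/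
lemma playVar_neg (hr : 0 ≤ r) (l : List ℝ) (y : ℝ) :
    playVar r (-y) (l.map (fun x => -x)) = playVar r y l := by
  induction l generalizing y with
  | nil => simp [playVar]
  | cons z l ih =>
    simp only [playVar, List.map_cons, clamp_neg hr, ih]
    rw [← abs_neg]; ring_nf

/-- The clamped value contracts distances, together with the cost of clamping. -/
lemma abs_sub_clamp_add_le (hr : 0 ≤ r) (z y y' : ℝ) :
    |y - clamp r z y| + |clamp r z y - clamp r z y'| ≤ |y - y'| + |y' - clamp r z y'| := by
  obtain ⟨h1, h2⟩ := clamp_mem hr z y'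
  rw [abs_sub_clamp_add hr h1 h2]
  exact abs_sub_le _ _ _

lemma playVar_lipschitz (hr : 0 ≤ r) (l : List ℝ) (y y' : ℝ) :
    playVar r y l ≤ |y - y'| + playVar r y' l := by
  induction l generalizing y y' with
  | nil => simp [playVar]
  | cons z l ih =>
    have h1 := ih (clamp r z y) (clamp r z y')
    have h2 := abs_sub_clamp_add_le hr z y y'
    simp only [playVar]; linarith

/-- The play operator has the least variation among all paths through the same tube. -/
lemma playVar_cons_le (hr : 0 ≤ r) (l : List ℝ) {z y y' : ℝ} (h1 : z - r ≤ y')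
    (h2 : y' ≤ z + r) : playVar r y (z :: l) ≤ |y - y'| + playVar r y' l := by
  have := playVar_lipschitz hr l (clamp r z y) y'
  have := abs_sub_clamp_add hr (y := y) h1 h2
  simp only [playVar]; linarith

lemma playVar_cons_of_mem (l : List ℝ) {z y : ℝ} (h1 : z - r ≤ y) (h2 : y ≤ z + r) :
    playVar r y (z :: l) = playVar r y l := by
  simp [playVar, clamp_of_mem h1 h2]

/-- The combination of the two play paths is admissible for the combined series because `r = a * r +
b * r`; it is at least as costly as the play, and the triangle inequality bounds its increments. -/
lemma playVar_convex (hr : 0 ≤ r) {a b : ℝ} (ha : 0 ≤ a) (hb : 0 ≤ b) (hab : a + b = 1) {T : ℕ}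
    (s t : Fin T → ℝ) (y y' : ℝ) :
    playVar r (a * y + b * y') (List.ofFn (a • s + b • t)) ≤
      a * playVar r y (List.ofFn s) + b * playVar r y' (List.ofFn t) := by
  induction T generalizing y y' with
  | zero => simp [playVar]
  | succ n ih =>
    rw [List.ofFn_succ, List.ofFn_succ, List.ofFn_succ]
    obtain ⟨h1, h2⟩ := clamp_mem hr (s 0) y
    obtain ⟨h3, h4⟩ := clamp_mem hr (t 0) y'
    have hb' : b = 1 - a := by linarith
    have key := ih (fun i => s i.succ) (fun i => t i.succ) (clamp r (s 0) y) (clamp r (t 0) y')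
    have h5 : (a • s + b • t) 0 - r ≤ a * clamp r (s 0) y + b * clamp r (t 0) y' := by
      simp only [Pi.add_apply, Pi.smul_apply, smul_eq_mul]
      have := mul_le_mul_of_nonneg_left h1 ha
      have := mul_le_mul_of_nonneg_left h3 hb
      have : r = a * r + b * r := by rw [← add_mul, hab, one_mul]
      linarith
    have h6 : a * clamp r (s 0) y + b * clamp r (t 0) y' ≤ (a • s + b • t) 0 + r := by
      simp only [Pi.add_apply, Pi.smul_apply, smul_eq_mul]
      have := mul_le_mul_of_nonneg_left h2 ha
      have := mul_le_mul_of_nonneg_left h4 hb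
      have : r = a * r + b * r := by rw [← add_mul, hab, one_mul]
      linarith
    refine (playVar_cons_le hr _ h5 h6).trans ?_
    have h7 : |a * y + b * y' - (a * clamp r (s 0) y + b * clamp r (t 0) y')| ≤
        a * |y - clamp r (s 0) y| + b * |y' - clamp r (t 0) y'| := by
      rw [← abs_of_nonneg ha, ← abs_of_nonneg hb, ← abs_mul, ← abs_mul, abs_of_nonneg ha,
        abs_of_nonneg hb]
      refine le_trans (le_of_eq ?_) (abs_add_le _ _)
      congr 1; ring
    simp only [playVar]
    have h8 : (fun i : Fin n => (a • s + b • t) i.succ) =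
      a • (fun i : Fin n => s i.succ) + b • (fun i : Fin n => t i.succ) := rfl
    rw [h8]
    linarith

/-! ### Reductions of the driving list -/

lemma playVar_append_congr {l₁ l₂ : List ℝ} {C : ℝ}
    (h : ∀ y, playVar r y l₁ = C + playVar r y l₂) (p : List ℝ) (y : ℝ) :
    playVar r y (p ++ l₁) = C + playVar r y (p ++ l₂) := by
  induction p generalizing y with
  | nil => exact h y
  | cons z p ih => simp only [List.cons_append, playVar, ih]; ring

/-- On a monotone stretch the play stands still or moves in one direction only, so the intermediate
stop `b` changes neither its end value nor its variation. -/
lemma playVar_between (hr : 0 ≤ r) {a b c : ℝ} (h : (a ≤ b ∧ b ≤ c) ∨ (c ≤ b ∧ b ≤ a))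
    (l : List ℝ) (y : ℝ) : playVar r y (a :: b :: c :: l) = playVar r y (a :: c :: l) := by
  simp only [playVar]
  obtain ⟨h1, h2⟩ := clamp_mem hr a y
  generalize clamp r a y = x at *
  have key : clamp r c (clamp r b x) = clamp r c x ∧
      |x - clamp r b x| + |clamp r b x - clamp r c (clamp r b x)| = |x - clamp r c x| := by
    rcases h with ⟨h3, h4⟩ | ⟨h3, h4⟩
    · rcases le_total x (b - r) with h5 | h5
      · rw [clamp_of_le hr h5, clamp_of_le hr (by linarith), clamp_of_le hr (by linarith),
          abs_of_nonpos (by linarith), abs_of_nonpos (by linarith), abs_of_nonpos (by linarith)]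
        exact ⟨rfl, by ring⟩
      · rw [clamp_of_mem h5 (by linarith)]; simp
    · rcases le_total x (b + r) with h5 | h5
      · rw [clamp_of_mem (by linarith) h5]; simp
      · rw [clamp_of_ge hr h5, clamp_of_ge hr (by linarith), clamp_of_ge hr (by linarith),
          abs_of_nonneg (by linarith), abs_of_nonneg (by linarith), abs_of_nonneg (by linarith)]
        exact ⟨rfl, by ring⟩
  rw [key.1] at *
  linarith [key.2]

lemma playVar_turningPoints (hr : 0 ≤ r) (l : List ℝ) (y : ℝ) :
    playVar r y (turningPoints l) = playVar r y l := by
  induction l using turningPoints.induct generalizing y with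
  | case1 => simp [turningPoints]
  | case2 a => simp [turningPoints]
  | case3 a =>
    obtain ⟨h1, h2⟩ := clamp_mem hr a y
    simp [turningPoints, playVar, clamp_of_mem h1 h2]
  | case4 a b h => simp [turningPoints, h]
  | case5 a b c l h ih => rw [turningPoints, if_pos h, ih, playVar_between hr h]
  | case6 a b c l h ih => rw [turningPoints, if_neg h]; simp only [playVar, ih]

/-- Removal of a full cycle `b, c`, ascending case. -/
lemma playVar_cycle_up (hr : 0 ≤ r) {a b c d : ℝ} (h1 : a ≤ c) (h2 : c ≤ b) (h3 : b ≤ d)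
    (l : List ℝ) (y : ℝ) : playVar r y (a :: b :: c :: d :: l) =
      2 * max (b - c - 2 * r) 0 + playVar r y (a :: d :: l) := by
  simp only [playVar]
  obtain ⟨h4, h5⟩ := clamp_mem hr a y
  generalize clamp r a y = x at *
  rcases le_total (b - c) (2 * r) with h6 | h6
  -- A shallow cycle: the value reached at `b` is still in the tube of `c`, so `c` has no effect and
  -- `b` is an intermediate point.
  · rw [max_eq_right (by linarith)]
    have h7 := playVar_between hr (a := a) (b := b) (c := d) (Or.inl ⟨by linarith, h3⟩) l x
    rw [playVar_cons_of_mem _ h4 h5, playVar_cons_of_mem _ h4 h5] at h7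
    simp only [playVar] at h7
    have h8 : clamp r c (clamp r b x) = clamp r b x := by
      rcases le_total x (b - r) with h9 | h9
      · rw [clamp_of_le hr h9]; exact clamp_of_mem (by linarith) (by linarith)
      · rw [clamp_of_mem h9 (by linarith)]; exact clamp_of_mem (by linarith) (by linarith)
    rw [h8]
    simp only [sub_self, abs_zero]
    linarith
  -- A deep cycle: the play visits `b - r`, `c + r`, `d - r`, so the stretch from `b - r` down to `c
  -- + r` is an excursion traversed twice.
  · rw [max_eq_left (by linarith), clamp_of_le hr (z := b) (by linarith),
      clamp_of_ge hr (z := c) (by linarith), clamp_of_le hr (z := d) (by linarith),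
      clamp_of_le hr (z := d) (by linarith), abs_of_nonpos (a := x - (b - r)) (by linarith),
      abs_of_nonneg (a := b - r - (c + r)) (by linarith),
      abs_of_nonpos (a := c + r - (d - r)) (by linarith),
      abs_of_nonpos (a := x - (d - r)) (by linarith)]
    ring

lemma playVar_cycle (hr : 0 ≤ r) {a b c d : ℝ}
    (h : (a ≤ c ∧ c ≤ b ∧ b ≤ d) ∨ (d ≤ b ∧ b ≤ c ∧ c ≤ a))
    (l : List ℝ) (y : ℝ) : playVar r y (a :: b :: c :: d :: l) =
      2 * max (|b - c| - 2 * r) 0 + playVar r y (a :: d :: l) := by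
  rcases h with ⟨h1, h2, h3⟩ | ⟨h1, h2, h3⟩
  · rw [playVar_cycle_up hr h1 h2 h3, abs_of_nonneg (by linarith)]
  · have := playVar_cycle_up hr (a := -a) (b := -b) (c := -c) (d := -d) (by linarith)
      (by linarith) (by linarith) (l.map fun x => -x) (-y)
    rw [← playVar_neg hr, ← playVar_neg hr (a :: d :: l), abs_of_nonpos (by linarith)]
    simp only [List.map_cons]
    rw [this]; ring_nf

/-! ### Least variation over all starts; time reversal -/

/-- Starting at the lower end of the tube of an upper bound is optimal among higher starts. -/
lemma playVar_ge_of_le (hr : 0 ≤ r) {M : ℝ} {l : List ℝ} (hl : ∀ z ∈ l, z ≤ M) {y : ℝ}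
    (hy : M - r ≤ y) : playVar r (M - r) l ≤ playVar r y l := by
  induction l generalizing M y with
  | nil => simp [playVar]
  | cons z l ih =>
    have hz : z ≤ M := hl z (by simp)
    have hl' : ∀ w ∈ l, w ≤ M := fun w hw => hl w (by simp [hw])
    rcases le_total (M - r) (z + r) with h | h
    · rw [playVar_cons_of_mem _ (by linarith) h]
      have h1 : M - r ≤ clamp r z y := le_max_of_le_right (le_min h hy)
      have := ih hl' h1
      have := abs_nonneg (y - clamp r z y)
      simp only [playVar]; linarith
    · simp only [playVar]
      rw [clamp_of_ge hr h, clamp_of_ge hr (h.trans hy), abs_of_nonneg (by linarith),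
        abs_of_nonneg (by linarith)]
      linarith

lemma forall_mem_map_neg {m : ℝ} {l : List ℝ} (hl : ∀ z ∈ l, m ≤ z) :
    ∀ z ∈ l.map (fun x => -x), z ≤ -m := by
  simp only [List.mem_map]
  rintro _ ⟨z, hz, rfl⟩
  linarith [hl z hz]

/-- Moving the starting point of a two-sided path past one entry. -/
lemma exists_playVar_shift (hr : 0 ≤ r) (z : ℝ) (l₁ l₂ : List ℝ) (y : ℝ) :
    ∃ y', playVar r y' (z :: l₁) + playVar r y' l₂ ≤ playVar r y l₁ + playVar r y (z :: l₂) := by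
  obtain ⟨h1, h2⟩ := clamp_mem hr z y
  -- From the clamped start `z` is free; the backward list costs at most `|y - clamp r z y|` more,
  -- the amount saved forward.
  refine ⟨clamp r z y, ?_⟩
  rw [playVar_cons_of_mem _ h1 h2]
  have := playVar_lipschitz hr l₁ (clamp r z y) y
  rw [abs_sub_comm] at this
  simp only [playVar]; linarith

/-- Both lists are read away from a common start, `l₁` backward in time; the entries of `p` pass one
by one from the future to the past. -/
lemma exists_playVar_split (hr : 0 ≤ r) (p l₁ l₂ : List ℝ) (y : ℝ) :
    ∃ y', playVar r y' (p.reverse ++ l₁) + playVar r y' l₂ ≤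
      playVar r y l₁ + playVar r y (p ++ l₂) := by
  induction p generalizing l₁ y with
  | nil => exact ⟨y, le_rfl⟩
  | cons z p ih =>
    obtain ⟨y₁, h1⟩ := exists_playVar_shift hr z l₁ (p ++ l₂) y
    obtain ⟨y₂, h2⟩ := ih (z :: l₁) y₁
    refine ⟨y₂, ?_⟩
    simp only [List.reverse_cons, List.append_assoc, List.cons_append]
    exact h2.trans h1

lemma exists_playVar_merge (hr : 0 ≤ r) (p l₁ l₂ : List ℝ) (y : ℝ) :
    ∃ y', playVar r y' l₁ + playVar r y' (p ++ l₂) ≤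
      playVar r y (p.reverse ++ l₁) + playVar r y l₂ := by
  obtain ⟨y', h⟩ := exists_playVar_split hr p.reverse l₂ l₁ y
  rw [List.reverse_reverse] at h
  exact ⟨y', by linarith⟩

/-- The least variation over all starting values, split at an upper bound of the list. -/
lemma isLeast_playVar_of_max (hr : 0 ≤ r) {M : ℝ} {p l : List ℝ} (hp : ∀ z ∈ p, z ≤ M)
    (hl : ∀ z ∈ l, z ≤ M) : IsLeast (Set.range fun y => playVar r y (p ++ M :: l))
      (playVar r (M - r) p.reverse + playVar r (M - r) l) := by
  have lower : ∀ y, playVar r (M - r) p.reverse + playVar r (M - r) l ≤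
      playVar r y (p ++ M :: l) := by
    intro y
    obtain ⟨y₁, h1⟩ := exists_playVar_split hr p [] (M :: l) y
    obtain ⟨y₂, h2⟩ := exists_playVar_shift hr M p.reverse l y₁
    obtain ⟨h3, h4⟩ := clamp_mem hr M y₂
    have h5 := playVar_ge_of_le hr (l := p.reverse) (M := M) (by simpa using hp) h3
    have h6 := playVar_ge_of_le hr hl h3
    have h7 := playVar_lipschitz hr l (clamp r M y₂) y₂
    rw [abs_sub_comm] at h7
    simp only [playVar, List.append_nil] at h1 h2
    linarith
  -- The bound is attained: the two-sided path from `M - r` is turned back into a forward one.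
  obtain ⟨y, hy⟩ := exists_playVar_merge hr p [] (M :: l) (M - r)
  rw [playVar_cons_of_mem _ (by linarith) (by linarith)] at hy
  simp only [playVar, List.append_nil, zero_add] at hy
  refine ⟨⟨y, le_antisymm hy (lower y)⟩, ?_⟩
  rintro _ ⟨y, rfl⟩
  exact lower y

lemma isLeast_playVar_of_min (hr : 0 ≤ r) {m : ℝ} {p l : List ℝ} (hp : ∀ z ∈ p, m ≤ z)
    (hl : ∀ z ∈ l, m ≤ z) : IsLeast (Set.range fun y => playVar r y (p ++ m :: l))
      (playVar r (m + r) p.reverse + playVar r (m + r) l) := by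
  have := isLeast_playVar_of_max hr (M := -m) (p := p.map fun x => -x) (l := l.map fun x => -x)
    (forall_mem_map_neg hp) (forall_mem_map_neg hl)
  rw [← List.map_reverse, show -m - r = -(m + r) by ring, playVar_neg hr, playVar_neg hr] at this
  have h2 : (Set.range fun y => playVar r y
      (p.map (fun x => -x) ++ -m :: l.map (fun x => -x))) =
      Set.range fun y => playVar r y (p ++ m :: l) := by
    have h3 : p.map (fun x => -x) ++ -m :: l.map (fun x => -x) =
      (p ++ m :: l).map fun x => -x := by simp
    rw [h3]
    refine (neg_surjective (G := ℝ)).range_comp (fun y => playVar r y _) |>.symm.trans ?_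
    congr 1; funext y; exact playVar_neg hr _ _
  rwa [h2] at this

/-! ### Alternating sequences and excesses -/

/-- Strict alternation; the flag tells whether the first step goes up. -/
def Zigzag : Bool → List ℝ → Prop
  | _, [] => True
  | _, [_] => True
  | e, a :: b :: l => (if e then a < b else b < a) ∧ Zigzag (!e) (b :: l)

/-- The ranges of consecutive points on a stack grow towards its bottom. -/
def RangesGrow : List ℝ → Prop
  | c :: b :: a :: st => |b - c| ≤ |a - b| ∧ RangesGrow (b :: a :: st)
  | _ => True

/-- The sum of the excesses of depths over the threshold `2 * r`. -/
noncomputable def excess (r : ℝ) (L : List ℝ) : ℝ := (L.map fun d => max (d - 2 * r) 0).sum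

@[simp] lemma excess_nil : excess r [] = 0 := by simp [excess]

@[simp] lemma excess_cons (d : ℝ) (L : List ℝ) :
    excess r (d :: L) = max (d - 2 * r) 0 + excess r L := by simp [excess]

@[simp] lemma excess_append (L L' : List ℝ) :
    excess r (L ++ L') = excess r L + excess r L' := by simp [excess]

lemma Zigzag.left {e : Bool} {p q : List ℝ} (h : Zigzag e (p ++ q)) : Zigzag e p := by
  induction p generalizing e with
  | nil => trivial
  | cons a p ih =>
    cases p with
    | nil => trivial
    | cons b p => exact ⟨h.1, ih h.2⟩

lemma Zigzag.tail {e : Bool} {a : ℝ} {l : List ℝ} (h : Zigzag e (a :: l)) : Zigzag (!e) l := by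
  cases l with
  | nil => trivial
  | cons b l => exact h.2

lemma Zigzag.right {e : Bool} {p q : List ℝ} (h : Zigzag e (p ++ q)) : ∃ e', Zigzag e' q := by
  induction p generalizing e with
  | nil => exact ⟨e, h⟩
  | cons a p ih => exact ih h.tail

lemma Zigzag.neg {e : Bool} {l : List ℝ} (h : Zigzag e l) :
    Zigzag (!e) (l.map fun x => -x) := by
  induction l generalizing e with
  | nil => trivial
  | cons a l ih =>
    cases l with
    | nil => trivial
    | cons b l =>
      refine ⟨?_, ih h.2⟩
      have := h.1
      cases e <;> simpa using this

/-- Reading an alternating sequence from one of its points in both directions. -/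
lemma Zigzag.reverse_append {e : Bool} {p st : List ℝ} {x : ℝ} {l : List ℝ}
    (h : Zigzag e (p ++ x :: l)) (hst : ∀ c ∈ (p ++ x :: l).head?, Zigzag e (c :: st)) :
    ∃ e', Zigzag e' (x :: (p.reverse ++ st)) ∧ Zigzag e' (x :: l) := by
  induction p generalizing e st with
  | nil => exact ⟨e, hst x (by simp), h⟩
  | cons c p ih =>
    have hc := hst c (by simp)
    have h2 : ∀ d ∈ (p ++ x :: l).head?, Zigzag (!e) (d :: c :: st) := by
      intro d hd
      obtain ⟨q, hq⟩ : ∃ q, p ++ x :: l = d :: q := by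
        cases p with
        | nil => simp at hd; exact ⟨l, by simp [hd]⟩
        | cons d' p => simp at hd; exact ⟨p ++ x :: l, by simp [hd]⟩
      rw [List.cons_append, hq] at h
      refine ⟨?_, by simpa using hc⟩
      have := h.1
      cases e <;> simpa using this
    obtain ⟨e', h3, h4⟩ := ih h.tail h2
    exact ⟨e', by simpa using h3, h4⟩

lemma fullCycles_neg (st l : List ℝ) :
    fullCycles (st.map fun x => -x) (l.map fun x => -x) = fullCycles st l := by
  have e (u v : ℝ) : |-u - -v| = |u - v| := by rw [← abs_neg]; ring_nf
  induction st, l using fullCycles.induct with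
  | case1 => simp [fullCycles]
  | case2 c b a st d l h ih =>
    simp only [List.map_cons] at ih ⊢
    rw [fullCycles, fullCycles, if_pos h, e, e, e, if_pos h, ih]
  | case3 c b a st d l h ih =>
    simp only [List.map_cons] at ih ⊢
    rw [fullCycles, fullCycles, if_neg h, e, e, e, if_neg h, ih]
  | case4 st d l h ih =>
    simp only [List.map_cons] at ih ⊢
    rw [fullCycles, fullCycles, ih]
    · exact h
    · intro c b a st' hst
      have h2 := congrArg (List.map fun x : ℝ => -x) hst
      simp only [List.map_map, List.map_cons] at h2
      refine h (-c) (-b) (-a) (st'.map fun x => -x) ?_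
      rw [← h2]; simp

lemma legDepths_neg (l : List ℝ) : legDepths (l.map fun x => -x) = legDepths l := by
  have h1 := fullCycles_neg [] l
  have h2 : halfCycleDepth (l.map fun x => -x) = halfCycleDepth l := by
    rcases List.eq_nil_or_concat l with rfl | ⟨q, b, rfl⟩
    · rfl
    · cases q with
      | nil => simp [halfCycleDepth]
      | cons a q =>
        simp only [halfCycleDepth, List.concat_eq_append, List.map_append, List.map_cons,
          List.cons_append, List.headD_cons, List.map_nil]
        rw [← List.cons_append, ← List.cons_append]
        simp only [List.getLastD_concat]
        rw [← abs_neg]; ring_nf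
  simp only [List.map_nil] at h1
  rw [legDepths, legDepths, h1, h2]

/-! ### Cost of a single piece -/

/-- The variation of the play operator along a piece reduces to that of its two ends and of the
full cycles that are removed from it. -/
lemma playVar_fullCycles (hr : 0 ≤ r) {x m : ℝ} (rest : List ℝ) (y : ℝ) (st l : List ℝ)
    (hst : ∀ z ∈ st, m ≤ z ∧ z ≤ x) (hl : ∀ z ∈ l, m ≤ z ∧ z ≤ x) (hdec : RangesGrow st)
    (hinv : (l = [] ∧ st = [m, x]) ∨ (l.getLast? = some m ∧ st.getLast? = some x ∧
      ∃ e, Zigzag e st ∧ ∀ c ∈ st.head?, Zigzag e (c :: l))) :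
    playVar r y (st.reverse ++ (l ++ rest)) =
      2 * excess r (fullCycles st l) + playVar r y (x :: m :: rest) := by
  -- Invariant: stack and unread points together alternate, from `x` at the bottom of the stack to
  -- the last unread point `m`; or everything is read and only the two ends remain.
  induction st, l using fullCycles.induct with
  | case1 st =>
    rcases hinv with ⟨-, rfl⟩ | ⟨h, -⟩
    · simp [fullCycles]
    · simp at h
  | case2 c b a st d l h ih =>
    rcases hinv with ⟨h1, -⟩ | ⟨hlast, hbot, e, hz, hz'⟩
    · simp at h1
    have hcl : Zigzag e (c :: d :: l) := hz' c (by simp)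
    -- Alternation and the range test put `b` and `c` between `a` and `d`, so after the removal `a,
    -- d` steps in the direction of `a, b`.
    have hord : ((if e then a < d else d < a) ∧
        ((a ≤ c ∧ c ≤ b ∧ b ≤ d) ∨ (d ≤ b ∧ b ≤ c ∧ c ≤ a))) := by
      have h1 := hz.1
      have h2 := hz.2.1
      have h3 := hcl.1
      have h4 := h.1
      have h5 := h.2
      cases e
      · simp only [Bool.not_false, if_true, Bool.false_eq_true, if_false] at h1 h2 h3 ⊢
        rw [abs_of_neg (by linarith), abs_of_pos (by linarith)] at h4 h5
        exact ⟨by linarith, Or.inr ⟨by linarith, by linarith, by linarith⟩⟩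
      · simp only [Bool.not_true, if_true, Bool.false_eq_true, if_false] at h1 h2 h3 ⊢
        rw [abs_of_pos (by linarith), abs_of_neg (by linarith)] at h4 h5
        exact ⟨by linarith, Or.inl ⟨by linarith, by linarith, by linarith⟩⟩
    have h2 := ih (fun z hz => hst z (by simp only [List.mem_cons] at hz ⊢; tauto)) hl
      (by
        have := hdec.2
        cases st with
        | nil => trivial
        | cons a' st => exact this.2)
      (Or.inr ⟨hlast, by simpa using hbot, e, by simpa using hz.2.2, by
        intro c' hc'
        simp only [List.head?_cons, Option.mem_def, Option.some.injEq] at hc'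
        subst hc'
        exact ⟨hord.1, hcl.2⟩⟩)
    rw [fullCycles, if_pos h, excess_cons]
    simp only [List.reverse_cons, List.append_assoc, List.cons_append, List.nil_append] at h2 ⊢
    rw [playVar_append_congr (fun y => playVar_cycle hr hord.2 (l ++ rest) y), h2]
    ring
  | case3 c b a st d l h ih =>
    rcases hinv with ⟨h1, -⟩ | ⟨hlast, hbot, e, hz, hz'⟩
    · simp at h1
    have hcl : Zigzag e (c :: d :: l) := hz' c (by simp)
    -- The stack already satisfies half of the test, so only the comparison with `d` can have
    -- failed; this keeps the ranges growing.
    have hlt : |c - d| < |b - c| := by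
      by_contra hcon
      exact h ⟨hdec.1, not_lt.1 hcon⟩
    -- Were `d` the last point, it would equal the lower bound `m`, and the range `|c - d|` could
    -- not be smaller than `|b - c|`.
    have hne : l ≠ [] := by
      rintro rfl
      simp only [List.getLast?_singleton, Option.some.injEq] at hlast
      subst hlast
      have h1 := hz.1
      have h3 := hcl.1
      have h4 := (hst b (by simp)).1
      have h5 := (hst c (by simp)).1
      cases e
      · simp only [Bool.false_eq_true, if_false] at h1 h3
        rw [abs_of_pos (by linarith), abs_of_neg (by linarith)] at hlt
        linarith
      · simp only [if_true] at h3
        linarith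
    have h2 := ih
      (fun z hz => by
        rcases List.mem_cons.1 hz with rfl | hz
        · exact hl _ (by simp)
        · exact hst z hz)
      (fun z hz => hl z (by simp [hz])) ⟨hlt.le, hdec⟩
      (Or.inr ⟨by
        obtain ⟨d', l', rfl⟩ := List.exists_cons_of_ne_nil hne
        simpa using hlast, by simpa using hbot, !e, ⟨by
          have := hcl.1
          cases e <;> simpa using this, by simpa using hz⟩, by
        intro c' hc'
        simp only [List.head?_cons, Option.mem_def, Option.some.injEq] at hc'
        subst hc'
        exact hcl.2⟩)
    rw [fullCycles, if_neg h, ← h2]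
    simp
  | case4 st d l h ih =>
    rcases hinv with ⟨h1, -⟩ | ⟨hlast, hbot, e, hz, hz'⟩
    · simp at h1
    have hshape : st = [x] ∨ ∃ c, st = [c, x] := by
      match st, hbot, h with
      | [], hbot, _ => simp at hbot
      | [c], hbot, _ => left; simpa using hbot
      | [c, b], hbot, _ => right; exact ⟨c, by simpa using hbot⟩
      | c :: b :: a :: st, _, h => exact (h c b a st rfl).elim
    have hd := hl d (by simp)
    have hstep : RangesGrow (d :: st) := by
      rcases hshape with rfl | ⟨c, rfl⟩
      · trivial
      · refine ⟨?_, trivial⟩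
        have h1 := hz.1
        have h3 := (hz' c (by simp)).1
        have h4 := (hst c (by simp)).2
        cases e
        · simp only [Bool.false_eq_true, if_false] at h1
          linarith
        · simp only [if_true] at h1 h3
          rw [abs_of_neg (by linarith), abs_of_pos (by linarith)]
          linarith
    have hrest : (l = [] ∧ d :: st = [m, x]) ∨ (l.getLast? = some m ∧
        (d :: st).getLast? = some x ∧
        ∃ e, Zigzag e (d :: st) ∧ ∀ c ∈ (d :: st).head?, Zigzag e (c :: l)) := by
      by_cases hne : l = []
      · subst hne
        simp only [List.getLast?_singleton, Option.some.injEq] at hlast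
        subst hlast
        left
        refine ⟨rfl, ?_⟩
        rcases hshape with rfl | ⟨c, rfl⟩
        · rfl
        · exfalso
          have h1 := hz.1
          have h3 := (hz' c (by simp)).1
          have h4 := hst c (by simp)
          cases e
          · simp only [Bool.false_eq_true, if_false] at h1
            linarith
          · simp only [if_true] at h3
            linarith
      · right
        refine ⟨?_, ?_, !e, ?_, ?_⟩
        · obtain ⟨d', l', rfl⟩ := List.exists_cons_of_ne_nil hne
          simpa using hlast
        · rcases hshape with rfl | ⟨c, rfl⟩ <;> simp
        · obtain ⟨c, st', rfl⟩ : ∃ c st', st = c :: st' := by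
            rcases hshape with rfl | ⟨c, rfl⟩
            · exact ⟨_, _, rfl⟩
            · exact ⟨_, _, rfl⟩
          refine ⟨?_, by simpa using hz⟩
          have := (hz' c (by simp)).1
          cases e <;> simpa using this
        · intro c' hc'
          simp only [List.head?_cons, Option.mem_def, Option.some.injEq] at hc'
          subst hc'
          rcases hshape with rfl | ⟨c, rfl⟩
          · exact (hz' x (by simp)).2
          · exact (hz' c (by simp)).2
    have h2 := ih
      (fun z hz => by
        rcases List.mem_cons.1 hz with rfl | hz
        · exact hd
        · exact hst z hz)
      (fun z hz => hl z (by simp [hz])) hstep hrest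
    rw [fullCycles]
    · rw [← h2]; simp
    · exact h

lemma playVar_eq_zero {l : List ℝ} {y : ℝ} (h : ∀ z ∈ l, z - r ≤ y ∧ y ≤ z + r) :
    playVar r y l = 0 := by
  induction l with
  | nil => rfl
  | cons z l ih =>
    rw [playVar_cons_of_mem _ (h z (by simp)).1 (h z (by simp)).2]
    exact ih fun w hw => h w (by simp [hw])

/-- The contribution of a descending piece. -/
lemma playVar_leg_down (hr : 0 ≤ r) {x m : ℝ} {p rest : List ℝ} {e : Bool}
    (hz : Zigzag e (x :: (p ++ [m]))) (hmx : m ≤ x) (hp : ∀ z ∈ p, m ≤ z ∧ z ≤ x)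
    (hrest : ∀ z ∈ rest, m ≤ z ∧ z ≤ x) :
    playVar r (x - r) (p ++ m :: rest) =
      excess r (legDepths (x :: (p ++ [m]))) + playVar r (m + r) rest := by
  have h1 := playVar_fullCycles hr (x := x) (m := m) rest (x - r) [x] (p ++ [m]) (by simp [hmx])
    (by
      intro z hz
      rcases List.mem_append.1 hz with hz | hz
      · exact hp z hz
      · simp only [List.mem_singleton] at hz; subst hz; exact ⟨le_rfl, hmx⟩)
    trivial
    (Or.inr ⟨by simp, rfl, e, trivial, by simpa using hz⟩)
  have h2 : fullCycles [] (x :: (p ++ [m])) = fullCycles [x] (p ++ [m]) := by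
    rw [fullCycles]; simp
  have h3 : halfCycleDepth (x :: (p ++ [m])) = x - m := by
    rw [halfCycleDepth, List.headD_cons, ← List.cons_append, List.getLastD_concat,
      abs_of_nonneg (by linarith)]
  rw [List.reverse_singleton, List.singleton_append, List.append_assoc, List.singleton_append,
    playVar_cons_of_mem _ (by linarith) (by linarith),
    playVar_cons_of_mem _ (by linarith) (by linarith)] at h1
  rw [h1, legDepths, h2, h3, excess_cons, excess_append]
  -- If `x - m ≤ 2 * r`, both `x - r` and `m + r` lie in the tube of every point of `[m, x]`, and
  -- neither start ever moves.
  have h4 : playVar r (x - r) (m :: rest) =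
      max (x - m - 2 * r) 0 + playVar r (m + r) rest := by
    rcases le_total (m + r) (x - r) with h | h
    · rw [playVar, clamp_of_ge hr h, abs_of_nonneg (by linarith), max_eq_left (by linarith)]
      ring
    · rw [playVar_cons_of_mem _ (by linarith) h, max_eq_right (by linarith),
        playVar_eq_zero, playVar_eq_zero, add_zero]
      · intro z hz; have := hrest z hz; constructor <;> linarith
      · intro z hz; have := hrest z hz; constructor <;> linarith
  rw [h4]; ring

/-- The contribution of an ascending piece. -/
lemma playVar_leg_up (hr : 0 ≤ r) {x m : ℝ} {p rest : List ℝ} {e : Bool}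
    (hz : Zigzag e (x :: (p ++ [m]))) (hmx : x ≤ m) (hp : ∀ z ∈ p, x ≤ z ∧ z ≤ m)
    (hrest : ∀ z ∈ rest, x ≤ z ∧ z ≤ m) :
    playVar r (x + r) (p ++ m :: rest) =
      excess r (legDepths (x :: (p ++ [m]))) + playVar r (m - r) rest := by
  have hneg : ∀ q : List ℝ, (∀ z ∈ q, x ≤ z ∧ z ≤ m) →
      ∀ z ∈ q.map (fun x => -x), -m ≤ z ∧ z ≤ -x := by
    intro q hq
    simp only [List.mem_map]
    rintro _ ⟨z, hz, rfl⟩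
    have := hq z hz
    constructor <;> linarith
  have h := playVar_leg_down hr (x := -x) (m := -m) (p := p.map fun x => -x)
    (rest := rest.map fun x => -x) (e := !e) (by simpa using hz.neg) (by linarith)
    (hneg p hp) (hneg rest hrest)
  have h1 := playVar_neg hr (p ++ m :: rest) (x + r)
  have h2 := playVar_neg hr rest (m - r)
  have h3 := legDepths_neg (x :: (p ++ [m]))
  simp only [List.map_cons, List.map_append, List.map_nil] at h1 h3
  rw [← h1, ← h2, ← h3, show -(x + r) = -x - r by ring, h, show -(m - r) = -m + r by ring]

/-! ### Chains of half cycles from an extremum -/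

lemma maxOf_eq {l : List ℝ} {y : ℝ} : y ∈ l → (∀ z ∈ l, z ≤ y) → maxOf l = y := by
  intro h1 h2
  rw [maxOf, List.max?_eq_some_iff.2 ⟨h1, h2⟩, Option.getD_some]

lemma minOf_eq {l : List ℝ} {y : ℝ} : y ∈ l → (∀ z ∈ l, y ≤ z) → minOf l = y := by
  intro h1 h2
  rw [minOf, List.min?_eq_some_iff.2 ⟨h1, h2⟩, Option.getD_some]

lemma maxOf_spec {l : List ℝ} (h : l ≠ []) : maxOf l ∈ l ∧ ∀ z ∈ l, z ≤ maxOf l := by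
  obtain ⟨y, hy⟩ := Option.ne_none_iff_exists'.1 (mt List.max?_eq_none_iff.1 h)
  have := List.max?_eq_some_iff.1 hy
  rwa [maxOf, hy, Option.getD_some]

lemma minOf_spec {l : List ℝ} (h : l ≠ []) : minOf l ∈ l ∧ ∀ z ∈ l, minOf l ≤ z := by
  obtain ⟨y, hy⟩ := Option.ne_none_iff_exists'.1 (mt List.min?_eq_none_iff.1 h)
  have := List.min?_eq_some_iff.1 hy
  rwa [minOf, hy, Option.getD_some]

lemma legs_append {x y : ℝ} {b : Bool} {p q : List ℝ} (hy : y ∉ p)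
    (h : (if b then maxOf (p ++ y :: q) else minOf (p ++ y :: q)) = y) :
    legs x b (p ++ y :: q) = (x :: (p ++ [y])) :: legs y (!b) q := by
  obtain ⟨z, zs, hzs⟩ : ∃ z zs, p ++ y :: q = z :: zs :=
    List.exists_cons_of_ne_nil (by simp)
  have h1 : (p ++ y :: q).idxOf y = p.length := by
    rw [List.idxOf_append_of_notMem hy, List.idxOf_cons_self, add_zero]
  have h2 : (p ++ y :: q).take (p.length + 1) = p ++ [y] := by
    simp [List.take_append]
  have h3 : (p ++ y :: q).drop (p.length + 1) = q := by
    simp [List.drop_append]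
  rw [hzs] at h h1 h2 h3 ⊢
  rw [legs]
  simp only [h, h1, h2, h3]

/-- Each piece ends at an extremum bounding all that follows, so the remainder is the same problem
in the opposite direction. Hence both directions are proved together, by induction on a length
bound. -/
lemma excess_legs (hr : 0 ≤ r) (n : ℕ) : ∀ l : List ℝ, l.length ≤ n → ∀ x e,
    Zigzag e (x :: l) →
    ((∀ z ∈ l, z ≤ x) →
      excess r ((legs x false l).flatMap legDepths) = playVar r (x - r) l) ∧
    ((∀ z ∈ l, x ≤ z) →
      excess r ((legs x true l).flatMap legDepths) = playVar r (x + r) l) := by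
  induction n with
  | zero =>
    intro l hl x e _
    obtain rfl : l = [] := List.length_eq_zero_iff.1 (Nat.le_zero.1 hl)
    simp [legs, playVar]
  | succ n ih =>
    intro l hl x e hz
    rcases eq_or_ne l [] with rfl | hne
    · simp [legs, playVar]
    constructor
    · intro hx
      obtain ⟨h1, h2⟩ := minOf_spec hne
      obtain ⟨p, q, hpq, hp⟩ := List.eq_append_cons_of_mem h1
      have h3 := legs_append (x := x) (b := false) (q := q) hp (by simp [← hpq])
      rw [← hpq] at h3
      generalize minOf l = m at *
      subst hpq
      rw [h3, List.flatMap_cons, excess_append]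
      have hz' : Zigzag e ((x :: (p ++ [m])) ++ q) := by simpa using hz
      obtain ⟨e', hq⟩ := Zigzag.right (p := x :: p) (q := m :: q) (by simpa using hz)
      have h4 := (ih q (by simp at hl; omega) m e' hq).2 fun z hz => h2 z (by simp [hz])
      rw [playVar_leg_down hr hz'.left (hx m h1)
        (fun z hz => ⟨h2 z (by simp [hz]), hx z (by simp [hz])⟩)
        (fun z hz => ⟨h2 z (by simp [hz]), hx z (by simp [hz])⟩)]
      rw [Bool.not_false, h4]
    · intro hx
      obtain ⟨h1, h2⟩ := maxOf_spec hne
      obtain ⟨p, q, hpq, hp⟩ := List.eq_append_cons_of_mem h1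
      have h3 := legs_append (x := x) (b := true) (q := q) hp (by simp [← hpq])
      rw [← hpq] at h3
      generalize maxOf l = m at *
      subst hpq
      rw [h3, List.flatMap_cons, excess_append]
      have hz' : Zigzag e ((x :: (p ++ [m])) ++ q) := by simpa using hz
      obtain ⟨e', hq⟩ := Zigzag.right (p := x :: p) (q := m :: q) (by simpa using hz)
      have h4 := (ih q (by simp at hl; omega) m e' hq).1 fun z hz => h2 z (by simp [hz])
      rw [playVar_leg_up hr hz'.left (hx m h1)
        (fun z hz => ⟨hx z (by simp [hz]), h2 z (by simp [hz])⟩)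
        (fun z hz => ⟨hx z (by simp [hz]), h2 z (by simp [hz])⟩)]
      rw [Bool.not_true, h4]

/-! ### Turning points alternate -/

lemma zigzag_turningPoints (l : List ℝ) : ∃ e, Zigzag e (turningPoints l) := by
  -- To prepend a retained point one must know that the first point of the tail survives and that
  -- its first step keeps the input's direction.
  suffices h : (∃ e, Zigzag e (turningPoints l)) ∧ ∀ a b l', l = a :: b :: l' →
      (a < b → ∃ c q, turningPoints l = a :: c :: q ∧ Zigzag true (a :: c :: q)) ∧
      (b < a → ∃ c q, turningPoints l = a :: c :: q ∧ Zigzag false (a :: c :: q)) from h.1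
  induction l using turningPoints.induct with
  | case1 => exact ⟨⟨true, by simp [turningPoints, Zigzag]⟩, by simp⟩
  | case2 a => exact ⟨⟨true, by simp [turningPoints, Zigzag]⟩, by simp⟩
  | case3 a =>
    refine ⟨⟨true, by simp [turningPoints, Zigzag]⟩, ?_⟩
    rintro a b l' h
    simp only [List.cons.injEq] at h
    obtain ⟨rfl, rfl, rfl⟩ := h
    simp
  | case4 a b hab =>
    have h : (a < b → ∃ c q, turningPoints [a, b] = a :: c :: q ∧ Zigzag true (a :: c :: q)) ∧
      (b < a → ∃ c q, turningPoints [a, b] = a :: c :: q ∧ Zigzag false (a :: c :: q)) := by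
      rw [turningPoints, if_neg hab]
      exact ⟨fun h => ⟨b, [], rfl, by simpa [Zigzag] using h⟩,
        fun h => ⟨b, [], rfl, by simpa [Zigzag] using h⟩⟩
    refine ⟨?_, ?_⟩
    · rcases lt_or_gt_of_ne hab with h' | h'
      · obtain ⟨c, q, h1, h2⟩ := h.1 h'
        exact ⟨_, h1 ▸ h2⟩
      · obtain ⟨c, q, h1, h2⟩ := h.2 h'
        exact ⟨_, h1 ▸ h2⟩
    · rintro a' b' l' h'
      simp only [List.cons.injEq] at h'
      obtain ⟨rfl, rfl, rfl⟩ := h'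
      exact h
  | case5 a b c l hb ih =>
    rw [turningPoints, if_pos hb]
    refine ⟨ih.1, ?_⟩
    rintro a' b' l' h'
    simp only [List.cons.injEq] at h'
    obtain ⟨rfl, rfl, rfl⟩ := h'
    have h2 := ih.2 a c l rfl
    constructor
    · intro h
      exact h2.1 (by rcases hb with hb | hb <;> linarith)
    · intro h
      exact h2.2 (by rcases hb with hb | hb <;> linarith)
  | case6 a b c l hb ih =>
    rw [turningPoints, if_neg hb]
    have h2 := ih.2 b c l rfl
    have h : (a < b → ∃ c' q, a :: turningPoints (b :: c :: l) = a :: c' :: q ∧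
          Zigzag true (a :: c' :: q)) ∧
        (b < a → ∃ c' q, a :: turningPoints (b :: c :: l) = a :: c' :: q ∧
          Zigzag false (a :: c' :: q)) := by
      constructor
      · intro h
        have hcb : c < b := by
          by_contra hcon
          exact hb (Or.inl ⟨h.le, not_lt.1 hcon⟩)
        obtain ⟨c', q, h3, h4⟩ := h2.2 hcb
        exact ⟨b, c' :: q, by rw [h3], by simpa using h, by simpa using h4⟩
      · intro h
        have hcb : b < c := by
          by_contra hcon
          exact hb (Or.inr ⟨not_lt.1 hcon, h.le⟩)
        obtain ⟨c', q, h3, h4⟩ := h2.1 hcb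
        exact ⟨b, c' :: q, by rw [h3], by simpa using h, by simpa using h4⟩
    refine ⟨?_, ?_⟩
    · have hab : a ≠ b := by
        rintro rfl
        rcases le_total a c with h' | h'
        · exact hb (Or.inl ⟨le_rfl, h'⟩)
        · exact hb (Or.inr ⟨h', le_rfl⟩)
      rcases lt_or_gt_of_ne hab with h' | h'
      · obtain ⟨c, q, h1, h2⟩ := h.1 h'
        exact ⟨_, h1 ▸ h2⟩
      · obtain ⟨c, q, h1, h2⟩ := h.2 h'
        exact ⟨_, h1 ▸ h2⟩
    · rintro a' b' l' h'
      simp only [List.cons.injEq] at h'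
      obtain ⟨rfl, rfl, rfl⟩ := h'
      exact h

/-! ### Cutting at the two global extrema -/

lemma take_drop_split (A C D : List ℝ) (x y : ℝ) :
    let p := A ++ x :: (C ++ y :: D)
    ((p.take (A.length + (C.length + 1) + 1)).drop A.length = x :: (C ++ [y])) ∧
      p.take A.length = A ∧ p.drop (A.length + (C.length + 1) + 1) = D := by
  intro p
  have h1 : p = (A ++ x :: (C ++ [y])) ++ D := by simp [p]
  have h2 : (A ++ x :: (C ++ [y])).length = A.length + (C.length + 1) + 1 := by simp; omega
  refine ⟨?_, List.take_left' rfl, ?_⟩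
  · rw [h1, List.take_left' h2, List.drop_left' rfl]
  · rw [h1, List.drop_left' h2]

lemma idxOf_split {A C D : List ℝ} {x y : ℝ} (hxA : x ∉ A) (hyA : y ∉ A) (hyC : y ∉ C)
    (hxy : x ≠ y) : (A ++ x :: (C ++ y :: D)).idxOf x = A.length ∧
      (A ++ x :: (C ++ y :: D)).idxOf y = A.length + (C.length + 1) := by
  rw [List.idxOf_append_of_notMem hxA, List.idxOf_append_of_notMem hyA, List.idxOf_cons_self,
    List.idxOf_cons_ne _ hxy, List.idxOf_append_of_notMem hyC, List.idxOf_cons_self]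
  exact ⟨rfl, rfl⟩

lemma allLegs_max_first {A C D : List ℝ} {x y : ℝ} (hxA : x ∉ A) (hyA : y ∉ A) (hyC : y ∉ C)
    (hxy : x ≠ y) (hx : ∀ z ∈ A ++ x :: (C ++ y :: D), z ≤ x)
    (hy : ∀ z ∈ A ++ x :: (C ++ y :: D), y ≤ z) :
    allLegs (A ++ x :: (C ++ y :: D)) =
      (x :: (C ++ [y])) :: (legs x false A.reverse ++ legs y true D) := by
  have h1 := maxOf_eq (by simp) hx
  have h2 := minOf_eq (by simp) hy
  obtain ⟨h3, h4⟩ := idxOf_split (D := D) hxA hyA hyC hxy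
  obtain ⟨h5, h6, h7⟩ := take_drop_split A C D x y
  simp only [allLegs, h1, h2, h3, h4, h5, h6, h7]
  rw [if_pos (by omega)]

lemma allLegs_min_first {A C D : List ℝ} {x y : ℝ} (hxA : x ∉ A) (hyA : y ∉ A) (hyC : y ∉ C)
    (hxy : x ≠ y) (hx : ∀ z ∈ A ++ x :: (C ++ y :: D), x ≤ z)
    (hy : ∀ z ∈ A ++ x :: (C ++ y :: D), z ≤ y) :
    allLegs (A ++ x :: (C ++ y :: D)) =
      (x :: (C ++ [y])) :: (legs x true A.reverse ++ legs y false D) := by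
  have h1 := minOf_eq (by simp) hx
  have h2 := maxOf_eq (by simp) hy
  obtain ⟨h3, h4⟩ := idxOf_split (D := D) hxA hyA hyC hxy
  obtain ⟨h5, h6, h7⟩ := take_drop_split A C D x y
  simp only [allLegs, h1, h2, h3, h4, h5, h6, h7]
  rw [if_neg (by omega), if_pos (by omega)]

/-- Here `x` is the earlier of the two extrema. The optimal path is cut at `x`; since `y` is the
opposite extremum, the forward chain from `x` is the main piece followed by the chain from `y`. -/
lemma isLeast_playVar_split (hr : 0 ≤ r) {e : Bool} {A C D : List ℝ} {x y : ℝ}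
    (hz : Zigzag e (A ++ x :: (C ++ y :: D)))
    (hxA : x ∉ A) (hyA : y ∉ A) (hyC : y ∉ C) (hxy : x ≠ y)
    (h : ((∀ z ∈ A ++ x :: (C ++ y :: D), z ≤ x) ∧ ∀ z ∈ A ++ x :: (C ++ y :: D), y ≤ z) ∨
      ((∀ z ∈ A ++ x :: (C ++ y :: D), x ≤ z) ∧ ∀ z ∈ A ++ x :: (C ++ y :: D), z ≤ y)) :
    IsLeast (Set.range fun s => playVar r s (A ++ x :: (C ++ y :: D)))
      (excess r ((allLegs (A ++ x :: (C ++ y :: D))).flatMap legDepths)) := by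
  obtain ⟨e', h1, h2⟩ := hz.reverse_append (st := []) (fun c _ => trivial)
  rw [List.append_nil] at h1
  have h3 := excess_legs hr _ A.reverse le_rfl x e' h1
  have h4 := excess_legs hr _ (C ++ y :: D) le_rfl x e' h2
  have hsub : ∀ z ∈ C ++ y :: D, z ∈ A ++ x :: (C ++ y :: D) := fun z hz =>
    List.mem_append_right _ (List.mem_cons_of_mem _ hz)
  rcases h with ⟨hx, hy⟩ | ⟨hx, hy⟩
  · have h5 := isLeast_playVar_of_max hr (p := A) (l := C ++ y :: D) (M := x)
      (fun z hz => hx z (by simp [hz])) (fun z hz => hx z (hsub z hz))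
    have h6 : minOf (C ++ y :: D) = y := minOf_eq (by simp) fun z hz => hy z (hsub z hz)
    rw [allLegs_max_first hxA hyA hyC hxy hx hy]
    rw [← h3.1 (fun z hz => hx z (by simp only [List.mem_reverse] at hz; simp [hz])),
      ← h4.1 (fun z hz => hx z (hsub z hz)),
      legs_append (b := false) hyC h6] at h5
    simp only [List.flatMap_cons, List.flatMap_append, excess_append, Bool.not_false] at h5 ⊢
    rwa [add_left_comm] at h5
  · have h5 := isLeast_playVar_of_min hr (p := A) (l := C ++ y :: D) (m := x)
      (fun z hz => hx z (by simp [hz])) (fun z hz => hx z (hsub z hz))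
    have h6 : maxOf (C ++ y :: D) = y := maxOf_eq (by simp) fun z hz => hy z (hsub z hz)
    rw [allLegs_min_first hxA hyA hyC hxy hx hy]
    rw [← h3.2 (fun z hz => hx z (by simp only [List.mem_reverse] at hz; simp [hz])),
      ← h4.2 (fun z hz => hx z (hsub z hz)),
      legs_append (b := true) hyC h6] at h5
    simp only [List.flatMap_cons, List.flatMap_append, excess_append, Bool.not_true] at h5 ⊢
    rwa [add_left_comm] at h5

/-- For a list of turning points, the rainflow excess over `2 * r` is the least variation of the
play operator of radius `r` over all starting values. -/
lemma isLeast_excess_allLegs (hr : 0 ≤ r) {e : Bool} {p : List ℝ} (hz : Zigzag e p) :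
    IsLeast (Set.range fun y => playVar r y p) (excess r ((allLegs p).flatMap legDepths)) := by
  have hnonneg : (0 : ℝ) ∈ lowerBounds (Set.range fun y => playVar r y p) := by
    rintro _ ⟨y, rfl⟩
    exact playVar_nonneg r p y
  rcases eq_or_ne p [] with rfl | hne
  · simp only [allLegs, List.idxOf_nil, lt_irrefl, if_false, List.flatMap_nil, excess_nil]
    exact ⟨⟨0, rfl⟩, hnonneg⟩
  obtain ⟨hM, hMax⟩ := maxOf_spec hne
  obtain ⟨hm, hMin⟩ := minOf_spec hne
  rcases eq_or_ne (maxOf p) (minOf p) with heq | hMm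
  · have h1 : allLegs p = [] := by simp [allLegs, heq]
    rw [h1, List.flatMap_nil, excess_nil]
    refine ⟨⟨maxOf p, playVar_eq_zero fun z hz => ?_⟩, hnonneg⟩
    have := hMax z hz
    have := hMin z hz
    constructor <;> linarith
  generalize maxOf p = M at *
  generalize minOf p = m at *
  obtain ⟨A, B, rfl, hMA⟩ := List.eq_append_cons_of_mem hM
  by_cases hmA : m ∈ A
  · obtain ⟨C, D, rfl, hmC⟩ := List.eq_append_cons_of_mem hmA
    simp only [List.mem_append, List.mem_cons, not_or] at hMA
    simp only [List.append_assoc, List.cons_append] at *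
    exact isLeast_playVar_split hr hz hmC hMA.1 hMA.2.2 hMm.symm (Or.inr ⟨hMin, hMax⟩)
  · have hmB : m ∈ B := by
      simp only [List.mem_append, List.mem_cons] at hm
      have := hMm.symm
      tauto
    obtain ⟨C, D, rfl, hmC⟩ := List.eq_append_cons_of_mem hmB
    exact isLeast_playVar_split hr hz hMA hmA hmC hMm (Or.inl ⟨hMax, hMin⟩)

lemma isLeast_excess_rainflow (hr : 0 ≤ r) (s : List ℝ) :
    IsLeast (Set.range fun y => playVar r y s) (excess r (rainflow s)) := by
  obtain ⟨e, he⟩ := zigzag_turningPoints s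
  have h := isLeast_excess_allLegs hr he
  simp only [playVar_turningPoints hr] at h
  exact h

/-! ### From hinges to general stress functions -/

lemma convexOn_degradationCost_hinge {h : ℝ} (hh : 0 ≤ h) (T : ℕ) :
    ConvexOn ℝ Set.univ (degradationCost (fun d => max (d - h) 0) (T := T)) := by
  have hr : 0 ≤ h / 2 := by linarith
  have hf (s : Fin T → ℝ) :
      IsLeast (Set.range fun y => playVar (h / 2) y (List.ofFn s))
        (degradationCost (fun d => max (d - h) 0) s) := by
    have := isLeast_excess_rainflow hr (List.ofFn s)
    rwa [excess, show 2 * (h / 2) = h by ring] at this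
  refine ⟨convex_univ, fun s _ t _ a b ha hb hab => ?_⟩
  obtain ⟨y, hy⟩ := (hf s).1
  obtain ⟨y', hy'⟩ := (hf t).1
  simp only at hy hy'
  rw [← hy, ← hy']
  -- With optimal starts `y`, `y'` for `s`, `t`, the start `a * y + b * y'` competes for the
  -- combined series.
  exact ((hf _).2 ⟨_, rfl⟩).trans (playVar_convex hr ha hb hab s t y y')

lemma fullCycles_nonneg (st l : List ℝ) : ∀ d ∈ fullCycles st l, 0 ≤ d := by
  induction st, l using fullCycles.induct with
  | case1 => simp [fullCycles]
  | case2 c b a st d l h ih =>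
    rw [fullCycles, if_pos h]
    exact List.forall_mem_cons.2 ⟨abs_nonneg _, ih⟩
  | case3 c b a st d l h ih =>
    rw [fullCycles, if_neg h]
    exact ih
  | case4 st d l h ih =>
    rw [fullCycles]
    · exact ih
    · exact h

lemma rainflow_nonneg (s : List ℝ) : ∀ d ∈ rainflow s, 0 ≤ d := by
  intro d hd
  obtain ⟨leg, -, hd⟩ := List.mem_flatMap.1 hd
  simp only [legDepths, List.mem_cons, List.mem_append, or_self] at hd
  rcases hd with rfl | hd
  · exact abs_nonneg _
  · exact fullCycles_nonneg _ _ d hd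

/-- A convex monotone function vanishing at `0` agrees on a finite set with an element of any
convex cone of functions that contains the hinges `x ↦ max (x - h) 0`. -/
lemma exists_eqOn_of_convexOn {Φ : ℝ → ℝ} (hconv : ConvexOn ℝ (Set.Ici (0 : ℝ)) Φ)
    (hmono : MonotoneOn Φ (Set.Ici (0 : ℝ))) (hzero : Φ 0 = 0) (K : (ℝ → ℝ) → Prop)
    (K_zero : K 0) (K_add : ∀ F G, K F → K G → K (F + G)) (K_smul : ∀ (c : ℝ) F, 0 ≤ c → K F → K (c • F))
    (K_hinge : ∀ h, 0 ≤ h → K fun x => max (x - h) 0) (S : Finset ℝ) (hS : ∀ x ∈ S, 0 ≤ x) :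
    ∃ F, K F ∧ ∀ x ∈ S, F x = Φ x := by
  -- The points are added in increasing order. To the right of the last node `m` the interpolant
  -- must be affine and below `Φ`, so that the next hinge gets a nonnegative coefficient.
  suffices h : ∃ F m p q, K F ∧ 0 ≤ m ∧ (m = 0 ∨ m ∈ S) ∧ (∀ x ∈ S, x ≤ m) ∧
      (∀ x ∈ S, F x = Φ x) ∧ F m = Φ m ∧ ∀ x, m ≤ x → F x = p * x + q ∧ F x ≤ Φ x by
    obtain ⟨F, m, p, q, h1, -, -, -, h2, -⟩ := h
    exact ⟨F, h1, h2⟩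
  induction S using Finset.induction_on_max with
  | empty =>
    refine ⟨0, 0, 0, 0, K_zero, le_rfl, Or.inl rfl, by simp, by simp, hzero.symm, fun x hx => ?_⟩
    have := hmono (Set.mem_Ici.2 le_rfl) (Set.mem_Ici.2 hx) hx
    exact ⟨by simp, by simpa [hzero] using this⟩
  | insert a S ha ih =>
    obtain ⟨F, m, p, q, hK, hm, hmS, hle, heq, hFm, hF⟩ := ih fun x hx => hS x (by simp [hx])
    have ha0 : 0 ≤ a := hS a (by simp)
    have hma : m ≤ a := by
      rcases hmS with rfl | h
      · exact ha0
      · exact (ha m h).le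
    rcases hma.eq_or_lt with rfl | hma
    · exact ⟨F, m, p, q, hK, hm, Or.inr (by simp), by
        simpa using hle, by
        intro x hx
        rcases Finset.mem_insert.1 hx with rfl | hx
        · exact hFm
        · exact heq x hx, hFm, hF⟩
    obtain ⟨hFa, hFa'⟩ := hF a hma.le
    obtain ⟨hFm', -⟩ := hF m le_rfl
    -- The change of slope at `m` that makes the new interpolant meet `Φ` at `a`.
    set c := (Φ a - F a) / (a - m) with hc
    have hc0 : 0 ≤ c := div_nonneg (by linarith) (by linarith)
    have hca : c * (a - m) = Φ a - F a := div_mul_cancel₀ _ (by linarith)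
    refine ⟨F + c • (fun x => max (x - m) 0), a, p + c, q - c * m,
      K_add _ _ hK (K_smul c _ hc0 (K_hinge m hm)), ha0, Or.inr (by simp), ?_, ?_, ?_, ?_⟩
    · intro x hx
      rcases Finset.mem_insert.1 hx with rfl | hx
      · exact le_rfl
      · exact (ha x hx).le
    · intro x hx
      simp only [Pi.add_apply, Pi.smul_apply, smul_eq_mul]
      rcases Finset.mem_insert.1 hx with rfl | hx
      · rw [max_eq_left (by linarith), hca]; ring
      · rw [max_eq_right (by linarith [hle x hx]), heq x hx]; ring
    · simp only [Pi.add_apply, Pi.smul_apply, smul_eq_mul]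
      rw [max_eq_left (by linarith), hca]; ring
    · intro x hx
      obtain ⟨hFx, -⟩ := hF x (by linarith)
      simp only [Pi.add_apply, Pi.smul_apply, smul_eq_mul]
      rw [max_eq_left (by linarith)]
      refine ⟨by rw [hFx]; ring, ?_⟩
      rcases hx.eq_or_lt with rfl | hx
      · rw [hca]; linarith
      -- Beyond `a`, convexity keeps `Φ` above its secant through `m` and `a`, whose slope is `p +
      -- c`.
      have h1 := hconv.slope_mono_adjacent (Set.mem_Ici.2 hm)
        (Set.mem_Ici.2 (by linarith : 0 ≤ x)) hma hx
      have h2 : (Φ a - Φ m) / (a - m) = p + c := by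
        rw [div_eq_iff (by linarith)]
        linarith
      rw [h2, le_div_iff₀ (by linarith)] at h1
      nlinarith

end Rainflow

theorem theorem1 (T : ℕ) (Φ : ℝ → ℝ)
    (hconv : ConvexOn ℝ (Set.Ici (0 : ℝ)) Φ) (hmono : MonotoneOn Φ (Set.Ici (0 : ℝ)))
    (hzero : Φ 0 = 0) :
    ConvexOn ℝ (Set.univ : Set (Fin T → ℝ)) (Rainflow.degradationCost Φ) := by
  refine ⟨convex_univ, fun s _ t _ a b ha hb hab => ?_⟩
  let depths (u : Fin T → ℝ) : List ℝ := Rainflow.rainflow (List.ofFn u)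
  let S : Finset ℝ := (depths s ++ depths t ++ depths (a • s + b • t)).toFinset
  obtain ⟨F, hF, hFS⟩ := Rainflow.exists_eqOn_of_convexOn hconv hmono hzero
    (fun F => ConvexOn ℝ (Set.univ : Set (Fin T → ℝ)) (Rainflow.degradationCost F))
    (by
      have : (Rainflow.degradationCost 0 : (Fin T → ℝ) → ℝ) = fun _ => 0 := by
        funext u; simp [Rainflow.degradationCost, Pi.zero_def]
      rw [this]
      exact convexOn_const 0 convex_univ)
    (fun F G hF hG => by
      have : (Rainflow.degradationCost (F + G) : (Fin T → ℝ) → ℝ) =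
          Rainflow.degradationCost F + Rainflow.degradationCost G := by
        funext u; simp [Rainflow.degradationCost, Pi.add_def, List.sum_map_add]
      rw [this]
      exact hF.add hG)
    (fun c F hc hF => by
      have : (Rainflow.degradationCost (c • F) : (Fin T → ℝ) → ℝ) =
          c • Rainflow.degradationCost F := by
        funext u; simp [Rainflow.degradationCost, Pi.smul_def, List.sum_map_mul_left]
      rw [this]
      exact hF.smul hc)
    (fun h hh => Rainflow.convexOn_degradationCost_hinge hh T) S
    (by
      intro x hx
      simp only [S, List.mem_toFinset, List.mem_append] at hx
      rcases hx with (hx | hx) | hx <;> exact Rainflow.rainflow_nonneg _ x hx)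
  have hcost (u : Fin T → ℝ) (hu : ∀ x ∈ depths u, x ∈ S) :
      Rainflow.degradationCost Φ u = Rainflow.degradationCost F u := by
    unfold Rainflow.degradationCost
    congr 1
    exact List.map_congr_left fun x hx => (hFS x (hu x hx)).symm
  rw [hcost s (fun x hx => by simp [S, hx]), hcost t (fun x hx => by simp [S, hx]),
    hcost (a • s + b • t) (fun x hx => by
      simp only [S, List.mem_toFinset, List.mem_append]; exact Or.inr hx)]
  exact hF.2 (Set.mem_univ s) (Set.mem_univ t) ha hb hab
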